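/- There is an absolute constant $c>0$ such that every finite connected vertex transitive digraph $D$ on $n\ge 2$ vertices contains a directed cycle of length at least $c\,n^{1/3}$. Here $D$ is connected if its underlying undirected graph is connected, and vertex transitive if for any two vertices $u,v$ some automorphism of $D$ maps $u$ to $v$. A directed cycle is a cyclic sequence of at least two distinct vertices with an arc from each vertex to the next, and its length is the number of its vertices. -/

import Mathlib

/-- A digraph is connected if its underlying undirected graph, obtained by forgetting the
directions of the arcs, is connected. -/
def Digraph.IsConnected {V : Type*} (D : Digraph V) : Prop :=
  D.toSimpleGraphInclusive.Connected

/-- A digraph is vertex transitive if for any two vertices `u`, `v` some automorphism of the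
digraph (a permutation of the vertices preserving arcs and non-arcs) maps `u` to `v`. -/
def Digraph.IsVertexTransitive {V : Type*} (D : Digraph V) : Prop :=
  ∀ u v : V, ∃ φ : D.Adj ≃r D.Adj, φ u = v

/-- A directed cycle of a digraph: a cyclic sequence of at least two pairwise distinct vertices
in which there is an arc from each vertex to the cyclically next one. Two opposite arcs form a
directed cycle of length two; a loop is not regarded as a directed cycle. The length of the
directed cycle (its number of arcs) is `C.length`. -/
def Digraph.IsDirectedCycle {V : Type*} (D : Digraph V) (C : Cycle V) : Prop :=
  2 ≤ C.length ∧ C.Nodup ∧ C.Chain D.Adj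

/-!
Let `ℓ` be the length of a longest directed cycle. Walk along a path, always deleting its vertices,
towards the strong component that contains more than half of the vertices, and release the oldest
vertex once `ℓ` vertices are deleted. If such a giant component survived forever, the released
vertex could be joined to it and close a cycle longer than `ℓ`; so some path `Z` on at most `ℓ`
vertices destroys the giant component. Then there is a set `A` of between a quarter and three
quarters of the vertices that arcs can leave only into `Z`.

Every arc lies on a directed cycle, so one can traverse it backwards in at most `ℓ` steps. Hence all
undirected edges between `A` and its complement lie in a ball of radius `O(ℓ)` about the start of
`Z`. In a finite connected vertex transitive graph such a cut has a side within the ball of twice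
the radius: otherwise an automorphism moves the cut far into one side, yielding a strictly smaller
cut of the same kind. So a quarter of the vertices lies in a ball of radius `O(ℓ)`, and packing
disjoint translates of that ball along a geodesic bounds the undirected diameter by `O(ℓ)` and the
directed diameter by `O(ℓ ^ 2)`.

Finally, move a shortest path between two vertices by a random automorphism: the path crosses from
`A` to its complement with probability at most `O(ℓ ^ 2) * |Z| / n`, while for random endpoints the
crossing has constant probability. Hence `n ≤ O(ℓ ^ 3)`.
-/

open Relation

lemma exists_nodup_isChain_of_reflTransGen {V : Type*} {r : V → V → Prop} {a b : V}
    (h : ReflTransGen r a b) :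
    ∃ L : List V, (a :: L).Nodup ∧ (a :: L).IsChain r ∧ (a :: L).getLast? = some b := by
  induction h using ReflTransGen.head_induction_on with
  | refl => exact ⟨[], by simp⟩
  | @head a c hac _ ih =>
    obtain ⟨L, hnodup, hchain, hlast⟩ := ih
    by_cases ha : a ∈ c :: L
    · obtain ⟨s, u, hsu⟩ := List.append_of_mem ha
      rw [hsu] at hnodup hchain hlast
      refine ⟨u, hnodup.of_append_right, hchain.right_of_append, ?_⟩
      rwa [List.getLast?_append_of_ne_nil _ (List.cons_ne_nil _ _)] at hlast
    · exact ⟨c :: L, List.nodup_cons.2 ⟨ha, hnodup⟩, hchain.cons_cons hac, by simpa using hlast⟩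

section Reachability

variable {V : Type*} {r : V → V → Prop} {Z Z' : Set V} {u v w : V}

/-- `ReachLE r k u v` says that `v` can be reached from `u` by at most `k` steps along `r`. -/
inductive ReachLE (r : V → V → Prop) : ℕ → V → V → Prop
  | refl (k : ℕ) (u : V) : ReachLE r k u u
  | head {k : ℕ} {u v w : V} : r u v → ReachLE r k v w → ReachLE r (k + 1) u w

namespace ReachLE

variable {j k : ℕ}

lemma mono (hjk : j ≤ k) (h : ReachLE r j u v) : ReachLE r k u v := by
  induction h generalizing k with
  | refl => exact refl _ _
  | head huv _ ih =>
    obtain ⟨k, rfl⟩ := Nat.exists_eq_add_of_le' (Nat.one_le_of_lt hjk)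
    exact head huv (ih (by omega))

lemma trans (huv : ReachLE r j u v) (hvw : ReachLE r k v w) : ReachLE r (j + k) u w := by
  induction huv with
  | refl j => exact hvw.mono (Nat.le_add_left k j)
  | @head j _ _ _ huv _ ih =>
    rw [Nat.add_right_comm]
    exact head huv (ih hvw)

lemma of_isChain {L : List V} (hL : (u :: L).IsChain r) (hv : v ∈ u :: L) :
    ReachLE r L.length u v := by
  induction L generalizing u with
  | nil => exact List.mem_singleton.1 hv ▸ refl _ _
  | cons c L ih =>
    rw [List.isChain_cons_cons] at hL
    rcases List.mem_cons.1 hv with rfl | hv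
    · exact refl _ _
    · exact head hL.1 (ih hL.2 hv)

end ReachLE

/-- `A` is out-closed relative to `Z`: every arc leaving `A` ends in `Z`. -/
def IsOutClosed (r : V → V → Prop) (Z A : Set V) : Prop :=
  ∀ ⦃a b⦄, a ∈ A → r a b → b ∈ A ∨ b ∈ Z

lemma IsOutClosed.union {A B : Set V} (hA : IsOutClosed r Z A) (hB : IsOutClosed r Z B) :
    IsOutClosed r Z (A ∪ B) := fun _ _ ha hab ↦
  ha.elim (fun ha ↦ (hA ha hab).imp_left .inl) fun ha ↦ (hB ha hab).imp_left .inr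

lemma IsOutClosed.inter {A B : Set V} (hA : IsOutClosed r Z A) (hB : IsOutClosed r Z B) :
    IsOutClosed r Z (A ∩ B) := fun _ _ ha hab ↦
  (hA ha.1 hab).elim (fun hb ↦ (hB ha.2 hab).imp_left (⟨hb, ·⟩)) .inr

lemma isOutClosed_compl (r : V → V → Prop) (Z : Set V) : IsOutClosed r Z Zᶜ :=
  fun _ _ _ _ ↦ (em _).symm

lemma ReachLE.exists_mem_of_isOutClosed {A : Set V} {k : ℕ} (h : ReachLE r k u v)
    (hA : IsOutClosed r Z A) (hu : u ∈ A) (hv : v ∉ A) : ∃ z ∈ Z, ReachLE r k u z := by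
  induction h with
  | refl => exact absurd hu hv
  | @head k _ w _ huw _ ih =>
    rcases hA hu huw with hw | hw
    · obtain ⟨z, hz, hwz⟩ := ih hw hv
      exact ⟨z, hz, head huw hwz⟩
    · exact ⟨w, hw, head huw (refl k w)⟩

/-- `AvoidReach r Z v w` says that `w` can be reached from `v` along `r` without entering `Z`;
the starting point `v` itself is allowed to lie in `Z`. -/
def AvoidReach (r : V → V → Prop) (Z : Set V) : V → V → Prop :=
  ReflTransGen fun a b ↦ r a b ∧ b ∉ Z

namespace AvoidReach

lemma mono (hZ : Z ⊆ Z') (h : AvoidReach r Z' v w) : AvoidReach r Z v w :=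
  ReflTransGen.mono (fun _ _ hab ↦ ⟨hab.1, fun hb ↦ hab.2 (hZ hb)⟩) _ _ h

lemma notMem (h : AvoidReach r Z v w) (hv : v ∉ Z) : w ∉ Z := by
  cases h with
  | refl => exact hv
  | tail _ hw => exact hw.2

lemma of_isChain {L : List V} (hL : (v :: L).IsChain r) (hZ : ∀ x ∈ L, x ∉ Z)
    (hw : w ∈ v :: L) : AvoidReach r Z v w := by
  induction L generalizing v with
  | nil => exact List.mem_singleton.1 hw ▸ .refl
  | cons c L ih =>
    rw [List.isChain_cons_cons] at hL
    rcases List.mem_cons.1 hw with rfl | hw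
    · exact .refl
    · exact .head ⟨hL.1, hZ c List.mem_cons_self⟩
        (ih hL.2 (fun x hx ↦ hZ x (List.mem_cons_of_mem _ hx)) hw)

lemma exists_nodup_isChain_cons (h : AvoidReach r Z v w) :
    ∃ L : List V, (v :: L).Nodup ∧ (v :: L).IsChain r ∧ (v :: L).getLast? = some w ∧
      ∀ x ∈ L, x ∉ Z := by
  obtain ⟨L, hnodup, hchain, hlast⟩ := exists_nodup_isChain_of_reflTransGen h
  refine ⟨L, hnodup, hchain.imp fun _ _ hab ↦ hab.1, hlast, fun x hx ↦ ?_⟩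
  obtain ⟨s, t, rfl⟩ := List.append_of_mem hx
  have hvx : ((v :: s) ++ x :: t).IsChain fun a b ↦ r a b ∧ b ∉ Z := hchain
  exact (hvx.rel_getLast_head_of_append (List.cons_ne_nil _ _) (List.cons_ne_nil _ _)).2

end AvoidReach

lemma isOutClosed_setOf_avoidReach (r : V → V → Prop) (Z : Set V) (v : V) :
    IsOutClosed r Z {w | AvoidReach r Z v w} := fun _ _ ha hab ↦
  or_iff_not_imp_right.2 fun hb ↦ ReflTransGen.tail ha ⟨hab, hb⟩

end Reachability

section GiantComponent

variable {V : Type*} {r : V → V → Prop} {Z Z' : Set V} {v w x : V}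

/-- The strong component of `v` after deletion of `Z`. -/
def strongComponent (r : V → V → Prop) (Z : Set V) (v : V) : Set V :=
  {w | AvoidReach r Z v w ∧ AvoidReach r Z w v}

/-- The strong component with more than half of all vertices that remains after deletion of `Z`;
it is empty if there is no such component. -/
def giantComponent (r : V → V → Prop) (Z : Set V) : Set V :=
  {v | v ∉ Z ∧ Nat.card V < 2 * (strongComponent r Z v).ncard}

lemma strongComponent_anti (hZ : Z ⊆ Z') : strongComponent r Z' v ⊆ strongComponent r Z v :=
  fun _ hw ↦ ⟨hw.1.mono hZ, hw.2.mono hZ⟩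

lemma strongComponent_eq (hw : w ∈ strongComponent r Z v) :
    strongComponent r Z w = strongComponent r Z v :=
  Set.ext fun _ ↦ ⟨fun hx ↦ ⟨hw.1.trans hx.1, hx.2.trans hw.2⟩,
    fun hx ↦ ⟨hw.2.trans hx.1, hx.2.trans hw.1⟩⟩

lemma AvoidReach.of_disjoint_strongComponent (hwx : AvoidReach r Z w x)
    (hvw : AvoidReach r Z v w) (hxv : AvoidReach r Z x v)
    (hZ' : Disjoint (strongComponent r Z v) Z') : AvoidReach r Z' w x := by
  induction hwx using ReflTransGen.head_induction_on with
  | refl => exact .refl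
  | @head a c hac hcx ih =>
    have hvc : AvoidReach r Z v c := hvw.tail hac
    exact .head ⟨hac.1, hZ'.notMem_of_mem_left ⟨hvc, hcx.trans hxv⟩⟩ (ih hvc)

lemma strongComponent_subset_giantComponent (hv : v ∈ giantComponent r Z) :
    strongComponent r Z v ⊆ giantComponent r Z := fun _ hw ↦
  ⟨hw.1.notMem hv.1, (strongComponent_eq hw).symm ▸ hv.2⟩

variable [Finite V]

lemma giantComponent_anti (hZ : Z ⊆ Z') : giantComponent r Z' ⊆ giantComponent r Z :=
  fun _ hv ↦ ⟨fun h ↦ hv.1 (hZ h), hv.2.trans_le <|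
    Nat.mul_le_mul_left 2 (Set.ncard_le_ncard (strongComponent_anti hZ))⟩

lemma giantComponent_eq_of_disjoint (hZ : Z ⊆ Z') (hd : Disjoint (giantComponent r Z) Z') :
    giantComponent r Z' = giantComponent r Z := by
  refine (giantComponent_anti hZ).antisymm fun v hv ↦ ⟨hd.notMem_of_mem_left hv, ?_⟩
  have hd' := hd.mono_left (strongComponent_subset_giantComponent hv)
  have hsub : strongComponent r Z v ⊆ strongComponent r Z' v := fun w hw ↦
    ⟨hw.1.of_disjoint_strongComponent .refl hw.2 hd',
      hw.2.of_disjoint_strongComponent hw.1 .refl hd'⟩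
  exact hv.2.trans_le (Nat.mul_le_mul_left 2 (Set.ncard_le_ncard hsub))

lemma avoidReach_of_mem_giantComponent (hv : v ∈ giantComponent r Z)
    (hw : w ∈ giantComponent r Z) : AvoidReach r Z v w := by
  have hmeet : ¬ Disjoint (strongComponent r Z v) (strongComponent r Z w) := fun hd ↦ by
    have hunion := Set.ncard_union_eq hd
    have hle := Set.ncard_le_card (strongComponent r Z v ∪ strongComponent r Z w)
    have := hv.2
    have := hw.2
    omega
  obtain ⟨x, hvx, hwx⟩ := Set.not_disjoint_iff.1 hmeet
  exact hvx.1.trans hwx.2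

lemma exists_forall_subset_or_superset [Nonempty V] {𝒞 : Set (Set V)} (hsup : SupClosed 𝒞)
    (hinf : InfClosed 𝒞) (hempty : ∅ ∈ 𝒞) (huniv : Set.univ ∈ 𝒞)
    (h𝒞 : ∀ A ∈ 𝒞, 4 * A.ncard < Nat.card V ∨ 4 * Aᶜ.ncard < Nat.card V) :
    ∃ S L : Set V, 4 * S.ncard < Nat.card V ∧ 4 * Lᶜ.ncard < Nat.card V ∧
      ∀ A ∈ 𝒞, A ⊆ S ∨ L ⊆ A := by
  obtain ⟨S, hS⟩ := (Set.toFinite {A ∈ 𝒞 | 4 * A.ncard < Nat.card V}).exists_maximal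
    ⟨∅, hempty, by simp⟩
  obtain ⟨L, hL⟩ := (Set.toFinite {A ∈ 𝒞 | 4 * Aᶜ.ncard < Nat.card V}).exists_minimal
    ⟨Set.univ, huniv, by simp⟩
  refine ⟨S, L, hS.prop.2, hL.prop.2, fun A hA ↦ (h𝒞 A hA).imp (fun hsmall ↦ ?_) fun hlarge ↦ ?_⟩
  · have hSA : S ∪ A ∈ 𝒞 := hsup hS.prop.1 hA
    refine Set.union_subset_iff.1 (hS.le_of_ge ⟨hSA, ?_⟩ Set.subset_union_left) |>.2
    refine (h𝒞 _ hSA).resolve_right fun hlarge ↦ ?_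
    have := hS.prop.2
    have := Set.ncard_union_le S A
    have := Set.ncard_add_ncard_compl (S ∪ A)
    omega
  · have hLA : L ∩ A ∈ 𝒞 := hinf hL.prop.1 hA
    refine Set.subset_inter_iff.1 (hL.le_of_le ⟨hLA, ?_⟩ Set.inter_subset_left) |>.2
    refine (h𝒞 _ hLA).resolve_left fun hsmall ↦ ?_
    have := hL.prop.2
    have := Set.ncard_union_le Lᶜ Aᶜ
    have := Set.ncard_add_ncard_compl (L ∩ A)
    rw [Set.compl_inter] at this
    omega

theorem exists_isOutClosed_of_giantComponent_eq_empty [Nonempty V]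
    (hZ : 4 * Z.ncard ≤ 3 * Nat.card V) (hempty : giantComponent r Z = ∅) :
    ∃ A, IsOutClosed r Z A ∧ Nat.card V ≤ 4 * A.ncard ∧ Nat.card V ≤ 4 * Aᶜ.ncard := by
  -- If every out-closed set is small or co-small, the largest small one `S` and the smallest
  -- co-small one `L` leave a strongly connected set `L \ S` of more than half of the vertices.
  by_contra! hunbalanced
  obtain ⟨S, L, hS, hL, hSL⟩ := exists_forall_subset_or_superset (𝒞 := {A | IsOutClosed r Z A})
    (fun _ hA _ hB ↦ hA.union hB) (fun _ hA _ hB ↦ hA.inter hB) (fun _ _ h ↦ h.elim)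
    (fun _ _ _ _ ↦ .inl trivial) fun A hA ↦ by
      have := hunbalanced A hA
      omega
  have hLZ : L ⊆ Zᶜ := (hSL _ (isOutClosed_compl r Z)).resolve_left fun hZS ↦ by
    have := Set.ncard_le_ncard hZS
    have := Set.ncard_add_ncard_compl Z
    omega
  have hreach : ∀ v ∈ L \ S, ∀ w ∈ L, AvoidReach r Z v w := fun v hv w hw ↦
    (hSL _ (isOutClosed_setOf_avoidReach r Z v)).resolve_left (fun h ↦ hv.2 (h .refl)) hw
  have hcard : Nat.card V < 2 * (L \ S).ncard := by
    have := Set.ncard_add_ncard_compl L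
    have := Set.le_ncard_sdiff S L
    omega
  obtain ⟨v, hv⟩ : (L \ S).Nonempty := by
    rw [← Set.ncard_pos]
    omega
  have hsub : L \ S ⊆ strongComponent r Z v := fun w hw ↦
    ⟨hreach v hv w hw.1, hreach w hw v hv.1⟩
  have hmem : v ∈ giantComponent r Z :=
    ⟨hLZ hv.1, hcard.trans_le (Nat.mul_le_mul_left 2 (Set.ncard_le_ncard hsub))⟩
  simp [hempty] at hmem

end GiantComponent

section PathSeparator

variable {V : Type*} {D : Digraph V} {r : V → V → Prop} {p q : V} {l w : List V} {ℓ : ℕ}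

lemma exists_isDirectedCycle_of_avoidReach (hch : (p :: l ++ [q]).IsChain D.Adj)
    (hnd : (p :: l ++ [q]).Nodup) (hqp : AvoidReach D.Adj {x | x ∈ l} q p) :
    ∃ C, D.IsDirectedCycle C ∧ l.length + 2 ≤ C.length ∧ ReachLE D.Adj C.length q p := by
  have hdisj := List.disjoint_of_nodup_append hnd
  have hne : q ≠ p := fun h ↦ hdisj List.mem_cons_self (h ▸ List.mem_singleton_self q)
  have hql : q ∉ l := fun h ↦ hdisj (List.mem_cons_of_mem p h) (List.mem_singleton_self q)
  obtain ⟨m, hmnd, hmch, hlast, hml⟩ := hqp.exists_nodup_isChain_cons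
  have hp : p ∈ q :: m := List.mem_of_getLast? hlast
  have hmpos : 0 < m.length := List.length_pos_of_mem ((List.mem_cons.1 hp).resolve_left hne.symm)
  have hreturn : (q :: m ++ (l ++ [q])).IsChain D.Adj := by
    obtain ⟨m', hm'⟩ := List.getLast?_eq_some_iff.1 hlast
    rw [hm']
    exact List.IsChain.append_overlap (l₃ := l ++ [q]) (hm' ▸ hmch) hch (List.cons_ne_nil p [])
  refine ⟨(q :: (m ++ l) : List V), ⟨?_, ?_, ?_⟩, ?_, ?_⟩
  · simp only [Cycle.length_coe, List.length_cons, List.length_append]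
    omega
  · rw [Cycle.nodup_coe_iff, ← List.cons_append]
    refine hmnd.append hnd.of_append_left.of_cons fun x hx hxl ↦ ?_
    rcases List.mem_cons.1 hx with rfl | hx
    exacts [hql hxl, hml x hx hxl]
  · rw [Cycle.chain_coe_cons, List.append_assoc]
    exact hreturn
  · simp only [Cycle.length_coe, List.length_cons, List.length_append]
    omega
  · refine (ReachLE.of_isChain hmch hp).mono ?_
    simp only [Cycle.length_coe, List.length_cons, List.length_append]
    omega

/-- A state of the search for a path that destroys the giant component: `l ++ w` is a path, `l` is
the set of deleted vertices, and `w` meets the giant component that remains. -/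
structure IsPathToGiant (r : V → V → Prop) (l w : List V) : Prop where
  isChain : (l ++ w).IsChain r
  nodup : (l ++ w).Nodup
  exists_mem_giantComponent : ∃ b ∈ w, b ∈ giantComponent r {x | x ∈ l}

/-- The lexicographic measure that decreases in each step of the search. -/
noncomputable def searchRank (r : V → V → Prop) (l w : List V) : ℕ ×ₗ ℕ :=
  toLex ((giantComponent r {x | x ∈ l}).ncard, w.length)

lemma setOf_mem_concat : {x | x ∈ l ++ [q]} = {x | x ∈ q :: l} := by
  ext
  simp [or_comm]

lemma ncard_setOf_mem_le (l : List V) : {x | x ∈ l}.ncard ≤ l.length := by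
  classical
  rw [← List.coe_toFinset, Set.ncard_coe_finset]
  exact List.toFinset_card_le l

variable [Finite V]

lemma giantComponent_mem_cons_eq (hp : p ∉ giantComponent r {x | x ∈ l}) :
    giantComponent r {x | x ∈ p :: l} = giantComponent r {x | x ∈ l} :=
  giantComponent_eq_of_disjoint (fun _ ↦ List.mem_cons_of_mem p) <|
    Set.disjoint_left.2 fun _ hy hyl ↦ (List.mem_cons.1 hyl).elim (fun h ↦ hp (h ▸ hy)) hy.1

lemma exists_isPathToGiant_of_mem (hch : (l ++ [q]).IsChain r) (hnd : (l ++ [q]).Nodup)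
    (hq : q ∈ giantComponent r {x | x ∈ l})
    (hne : (giantComponent r {x | x ∈ l ++ [q]}).Nonempty) :
    ∃ w, IsPathToGiant r (l ++ [q]) w := by
  obtain ⟨b, hb⟩ := hne
  have hbl : b ∈ giantComponent r {x | x ∈ l} :=
    giantComponent_anti (fun _ ↦ List.mem_append_left [q]) hb
  have hbq : b ≠ q := fun h ↦ hb.1 (by simp [h])
  obtain ⟨w, hwnd, hwch, hlast, hwl⟩ :=
    (avoidReach_of_mem_giantComponent hq hbl).exists_nodup_isChain_cons
  refine ⟨w, hch.append_overlap hwch (List.cons_ne_nil _ _), ?_, b,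
    (List.mem_cons.1 (List.mem_of_getLast? hlast)).resolve_left hbq, hb⟩
  rw [List.append_assoc]
  refine hnd.of_append_left.append hwnd fun x hx hxw ↦ ?_
  rcases List.mem_cons.1 hxw with rfl | hxw
  exacts [hq.1 hx, hwl x hxw hx]

namespace IsPathToGiant

lemma tail (h : IsPathToGiant r (p :: l) w) (hp : p ∉ giantComponent r {x | x ∈ l}) :
    IsPathToGiant r l w :=
  ⟨h.isChain.tail, h.nodup.of_cons, giantComponent_mem_cons_eq hp ▸ h.exists_mem_giantComponent⟩

lemma exists_isDirectedCycle (h : IsPathToGiant D.Adj (p :: l) w)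
    (hp : p ∈ giantComponent D.Adj {x | x ∈ l}) :
    ∃ C, D.IsDirectedCycle C ∧ l.length + 2 ≤ C.length := by
  obtain ⟨b, hbw, hb⟩ := h.exists_mem_giantComponent
  obtain ⟨q, w, rfl⟩ := List.exists_cons_of_ne_nil (List.ne_nil_of_mem hbw)
  have hqb : AvoidReach D.Adj {x | x ∈ l} q b := by
    refine .of_isChain h.isChain.right_of_append (fun x hx hxl ↦ ?_) hbw
    exact List.disjoint_of_nodup_append h.nodup (List.mem_cons_of_mem p hxl)
      (List.mem_cons_of_mem q hx)
  have hbp : AvoidReach D.Adj {x | x ∈ l} b p := avoidReach_of_mem_giantComponent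
    (giantComponent_anti (fun _ ↦ List.mem_cons_of_mem p) hb) hp
  have hch := h.isChain
  have hnd := h.nodup
  rw [List.append_cons] at hch hnd
  obtain ⟨C, hC, hlen, -⟩ := exists_isDirectedCycle_of_avoidReach hch.left_of_append
    hnd.of_append_left (hqb.trans hbp)
  exact ⟨C, hC, hlen⟩

lemma exists_searchRank_lt (h : IsPathToGiant r l w)
    (hne : ∀ L : List V, L.IsChain r → L.length ≤ l.length + 1 →
      (giantComponent r {x | x ∈ L}).Nonempty) :
    ∃ q w', IsPathToGiant r (l ++ [q]) w' ∧ searchRank r (l ++ [q]) w' < searchRank r l w := by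
  obtain ⟨b, hbw, hb⟩ := h.exists_mem_giantComponent
  obtain ⟨q, w, rfl⟩ := List.exists_cons_of_ne_nil (List.ne_nil_of_mem hbw)
  have hch := h.isChain
  have hnd := h.nodup
  rw [List.append_cons] at hch hnd
  refine ⟨q, ?_⟩
  by_cases hq : q ∈ giantComponent r {x | x ∈ l}
  · obtain ⟨w', hw'⟩ := exists_isPathToGiant_of_mem hch.left_of_append hnd.of_append_left hq
      (hne _ hch.left_of_append (by simp))
    have hlt : giantComponent r {x | x ∈ l ++ [q]} ⊂ giantComponent r {x | x ∈ l} :=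
      ⟨giantComponent_anti fun _ ↦ List.mem_append_left [q], fun hsub ↦ (hsub hq).1 (by simp)⟩
    exact ⟨w', hw', Prod.Lex.toLex_lt_toLex.2 (.inl (Set.ncard_lt_ncard hlt))⟩
  · have heq : giantComponent r {x | x ∈ l ++ [q]} = giantComponent r {x | x ∈ l} := by
      rw [setOf_mem_concat, giantComponent_mem_cons_eq hq]
    have hbw' : b ∈ w := (List.mem_cons.1 hbw).resolve_left fun hbq ↦ hq (hbq ▸ hb)
    exact ⟨w, ⟨hch, hnd, b, hbw', heq ▸ hb⟩,
      Prod.Lex.toLex_lt_toLex.2 (.inr ⟨congrArg Set.ncard heq, Nat.lt_succ_self _⟩)⟩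

end IsPathToGiant

theorem exists_isChain_giantComponent_eq_empty (hpos : 0 < ℓ)
    (hℓ : ∀ C, D.IsDirectedCycle C → C.length ≤ ℓ) :
    ∃ l : List V, l.IsChain D.Adj ∧ l.length ≤ ℓ ∧ giantComponent D.Adj {x | x ∈ l} = ∅ := by
  by_contra! hne
  have hstuck (l w : List V) (hlen : l.length ≤ ℓ) : ¬ IsPathToGiant D.Adj l w := by
    induction hrank : searchRank D.Adj l w using WellFoundedLT.induction generalizing l w with
    | ind s ih =>
    subst hrank
    have hextend (l' : List V) (hlen' : l'.length < ℓ)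
        (heq : searchRank D.Adj l' w = searchRank D.Adj l w) : ¬ IsPathToGiant D.Adj l' w := by
      intro h
      obtain ⟨q, w', hw', hlt⟩ := h.exists_searchRank_lt
        fun L hL hLlen ↦ hne L hL (hLlen.trans hlen')
      exact ih _ (heq ▸ hlt) _ _ (by simpa using hlen') rfl hw'
    intro h
    -- A full path gives up its first vertex `p`: if `p` returned to the giant component, the path
    -- could be closed to a cycle on more than `ℓ` vertices.
    rcases hlen.lt_or_eq with hlt | rfl
    · exact hextend l hlt rfl h
    · obtain ⟨p, l, rfl⟩ := List.exists_cons_of_length_pos hpos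
      by_cases hp : p ∈ giantComponent D.Adj {x | x ∈ l}
      · obtain ⟨C, hC, hlong⟩ := h.exists_isDirectedCycle hp
        have := hℓ C hC
        grind
      · exact hextend l (by simp)
          (by rw [searchRank, searchRank, giantComponent_mem_cons_eq hp]) (h.tail hp)
  obtain ⟨q, hq⟩ := hne [] .nil (Nat.zero_le ℓ)
  exact hstuck [] [q] (Nat.zero_le ℓ) ⟨.singleton q, List.nodup_singleton q, q, by simp, hq⟩

theorem exists_isOutClosed_isChain [Nonempty V] (hpos : 0 < ℓ)
    (hℓ : ∀ C, D.IsDirectedCycle C → C.length ≤ ℓ) (hcard : 4 * ℓ ≤ 3 * Nat.card V) :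
    ∃ (l : List V) (A : Set V), l.IsChain D.Adj ∧ l.length ≤ ℓ ∧
      IsOutClosed D.Adj {x | x ∈ l} A ∧ Nat.card V ≤ 4 * A.ncard ∧ Nat.card V ≤ 4 * Aᶜ.ncard := by
  obtain ⟨l, hch, hlen, hempty⟩ := exists_isChain_giantComponent_eq_empty hpos hℓ
  obtain ⟨A, hA⟩ := exists_isOutClosed_of_giantComponent_eq_empty
    (by linarith [ncard_setOf_mem_le l]) hempty
  exact ⟨l, A, hch, hlen, hA⟩

end PathSeparator

section Cuts

variable {V W : Type*} {G : SimpleGraph V} {H : SimpleGraph W} {S T : Set V} {x y z : V} {r : ℕ}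

lemma edist_map_le (f : G →g H) (u v : V) : H.edist (f u) (f v) ≤ G.edist u v :=
  le_iInf fun p ↦ (SimpleGraph.edist_le (p.map f)).trans_eq (by rw [SimpleGraph.Walk.length_map])

lemma dist_map_iso (φ : G ≃g H) (u v : V) : H.dist (φ u) (φ v) = G.dist u v := by
  have hle : G.edist u v ≤ H.edist (φ u) (φ v) := by
    simpa using edist_map_le φ.symm.toHom (φ u) (φ v)
  exact congrArg ENat.toNat ((edist_map_le φ.toHom u v).antisymm hle)

/-- Both ends of every edge between `S` and its complement are within distance `r` of `x`. -/
def IsCutNear (G : SimpleGraph V) (S : Set V) (x : V) (r : ℕ) : Prop :=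
  ∀ ⦃a b⦄, a ∈ S → b ∉ S → G.Adj a b → G.dist x a ≤ r ∧ G.dist x b ≤ r

namespace IsCutNear

lemma compl (h : IsCutNear G S x r) : IsCutNear G Sᶜ x r :=
  fun _ _ ha hb hab ↦ (h (not_not.1 hb) ha hab.symm).symm

lemma image (h : IsCutNear G S x r) (φ : G ≃g H) : IsCutNear H (φ '' S) (φ x) r := by
  rintro _ b ⟨a, ha, rfl⟩ hb hab
  obtain ⟨b, rfl⟩ := φ.surjective b
  rw [dist_map_iso, dist_map_iso]
  exact h ha (fun hbS ↦ hb (Set.mem_image_of_mem φ hbS)) (φ.map_adj_iff.1 hab)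

lemma mem_of_dist_le (hS : IsCutNear G S x r) (hG : G.Connected) (hy : y ∈ S)
    (hxy : 2 * r < G.dist x y) (hyz : G.dist y z ≤ r) : z ∈ S := by
  classical
  by_contra hz
  obtain ⟨p, hp⟩ := hG.exists_walk_length_eq_dist y z
  obtain ⟨d, hdp, hd, hd'⟩ := p.exists_boundary_dart S hy hz
  have hdsupp := p.dart_fst_mem_support_of_mem_darts hdp
  have hxd : G.dist x d.fst ≤ r := (hS hd hd' d.adj).1
  have hdy : G.dist d.fst y ≤ r := by
    rw [SimpleGraph.dist_comm]
    exact (SimpleGraph.dist_le _).trans <|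
      (p.length_takeUntil_le_length hdsupp).trans (hp.trans_le hyz)
  have := hG.dist_triangle (u := x) (v := d.fst) (w := y)
  omega

lemma subset (hS : IsCutNear G S x r) (hT : IsCutNear G T y r) (hG : G.Connected)
    (hy : y ∈ S) (hx : x ∉ T) (hxy : 2 * r < G.dist x y) : T ⊆ S := by
  by_contra hTS
  obtain ⟨w, hwT, hwS⟩ := Set.not_subset.1 hTS
  obtain ⟨p⟩ := hG.preconnected w y
  obtain ⟨d, -, ⟨hdT, hdS⟩, hd'⟩ := p.exists_boundary_dart (T \ S) ⟨hwT, hwS⟩ (fun h ↦ h.2 hy)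
  by_cases hdT' : d.snd ∈ T
  · have hdS' : d.snd ∈ S := by_contra fun h ↦ hd' ⟨hdT', h⟩
    have hyx : 2 * r < G.dist y x := by rwa [SimpleGraph.dist_comm]
    exact hT.compl.mem_of_dist_le hG hx hyx (hS hdS' hdS d.adj.symm).2 hdT
  · exact hdS (hS.mem_of_dist_le hG hy hxy (hT hdT hdT' d.adj).1)

lemma ssubset (hS : IsCutNear G S x r) (hT : IsCutNear G T y r) (hG : G.Connected)
    (hy : y ∈ S) (hx : x ∉ T) (hxy : 2 * r < G.dist x y) : T ⊂ S := by
  refine (hS.subset hT hG hy hx hxy).ssubset_of_ne ?_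
  rintro rfl
  obtain ⟨p⟩ := hG.preconnected y x
  obtain ⟨d, -, hd, hd'⟩ := p.exists_boundary_dart T hy hx
  have hxd : G.dist x d.fst ≤ r := (hS hd hd' d.adj).1
  have hyd : G.dist y d.fst ≤ r := (hT hd hd' d.adj).1
  have := hG.dist_triangle (u := x) (v := d.fst) (w := y)
  rw [SimpleGraph.dist_comm (u := d.fst)] at this
  omega

end IsCutNear

/-- A cut whose edges lie in a ball although both of its sides leave the ball of twice the
radius. -/
structure IsDeepCut (G : SimpleGraph V) (S : Set V) (x : V) (r : ℕ) : Prop where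
  isCutNear : IsCutNear G S x r
  exists_mem : ∃ y ∈ S, 2 * r < G.dist x y
  exists_notMem : ∃ z ∉ S, 2 * r < G.dist x z

namespace IsDeepCut

lemma compl (h : IsDeepCut G S x r) : IsDeepCut G Sᶜ x r :=
  ⟨h.isCutNear.compl, h.exists_notMem, by simpa using h.exists_mem⟩

lemma image (h : IsDeepCut G S x r) (φ : G ≃g H) : IsDeepCut H (φ '' S) (φ x) r := by
  obtain ⟨y, hy, hxy⟩ := h.exists_mem
  obtain ⟨z, hz, hxz⟩ := h.exists_notMem
  refine ⟨h.isCutNear.image φ, ⟨φ y, Set.mem_image_of_mem φ hy, ?_⟩, ⟨φ z, ?_, ?_⟩⟩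
  · rwa [dist_map_iso]
  · rwa [φ.injective.mem_set_image]
  · rwa [dist_map_iso]

end IsDeepCut

theorem not_isDeepCut [Finite V] (hG : G.Connected) (htr : ∀ u v : V, ∃ φ : G ≃g G, φ u = v) :
    ¬ IsDeepCut G S x r := by
  induction hcard : S.ncard using Nat.strong_induction_on generalizing S x with
  | _ n ih =>
  subst hcard
  intro hS
  obtain ⟨y, hy, hxy⟩ := hS.exists_mem
  obtain ⟨φ, rfl⟩ := htr x y
  -- Of the cut moved to `φ x` and its complement, the one that misses `x` lies strictly inside `S`.
  have hdescend (T : Set V) (hT : IsDeepCut G T (φ x) r) : x ∈ T := by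
    by_contra hx
    have hlt := Set.ncard_lt_ncard (hS.isCutNear.ssubset hT.isCutNear hG hy hx hxy)
    exact ih _ hlt rfl hT
  exact hdescend _ (hS.image φ).compl (hdescend _ (hS.image φ))

end Cuts

section Packing

variable {V : Type*} {G : SimpleGraph V} {u v x : V} {R m : ℕ}

lemma dist_getVert_of_length_eq_dist (p : G.Walk u v) (hp : p.length = G.dist u v) {k : ℕ}
    (hk : k ≤ p.length) : G.dist u (p.getVert k) = k := by
  rw [← SimpleGraph.length_eq_dist_of_subwalk hp (p.isSubwalk_take k), p.take_length,
    min_eq_left hk]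

theorem succ_mul_ncard_ball_le_card [Finite V] (hG : G.Connected)
    (htr : ∀ u v : V, ∃ φ : G ≃g G, φ u = v) (x : V) (h : m * (2 * R + 1) ≤ G.dist u v) :
    (m + 1) * {z | G.dist x z ≤ R}.ncard ≤ Nat.card V := by
  obtain ⟨p, hp⟩ := hG.exists_walk_length_eq_dist u v
  let c (i : ℕ) : V := p.getVert (i * (2 * R + 1))
  have hc {i : ℕ} (hi : i < m + 1) : G.dist u (c i) = i * (2 * R + 1) :=
    dist_getVert_of_length_eq_dist p hp <|
      (Nat.mul_le_mul_right _ (Nat.le_of_lt_succ hi)).trans (h.trans_eq hp.symm)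
  have hle {i j : ℕ} (hi : i < m + 1) (hj : j < m + 1) {z : V} (hiz : G.dist (c i) z ≤ R)
      (hjz : G.dist (c j) z ≤ R) : i ≤ j := by
    by_contra! hji
    have hstep := Nat.mul_le_mul_right (2 * R + 1) (Nat.succ_le_of_lt hji)
    have hu := hG.dist_triangle (u := u) (v := c j) (w := c i)
    have hz := hG.dist_triangle (u := c j) (v := z) (w := c i)
    rw [Nat.succ_mul] at hstep
    rw [hc hi, hc hj] at hu
    rw [SimpleGraph.dist_comm (u := z)] at hz
    omega
  choose φ hφ using fun i ↦ htr x (c i)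
  have hmem (i : ℕ) {z : V} (hz : G.dist x z ≤ R) : G.dist (c i) (φ i z) ≤ R := by
    rwa [← hφ, dist_map_iso]
  have hinj : Function.Injective fun a : Fin (m + 1) × {z | G.dist x z ≤ R} ↦ φ a.1 a.2 := by
    rintro ⟨i, z⟩ ⟨j, w⟩ (heq : φ i z = φ j w)
    have hz := hmem i z.2
    have hw := hmem j w.2
    have hij : i = j := Fin.ext <|
      (hle i.2 j.2 hz (heq ▸ hw)).antisymm (hle j.2 i.2 hw (heq ▸ hz))
    subst hij
    exact Prod.ext rfl (Subtype.ext ((φ i).injective heq))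
  simpa [Nat.card_prod] using Nat.card_le_card_of_injective _ hinj

theorem dist_lt_of_isCutNear [Finite V] {S : Set V} {r : ℕ} (hG : G.Connected)
    (htr : ∀ u v : V, ∃ φ : G ≃g G, φ u = v) (hS : IsCutNear G S x r)
    (hcard : Nat.card V ≤ 4 * S.ncard) (hcard' : Nat.card V ≤ 4 * Sᶜ.ncard) (u v : V) :
    G.dist u v < 4 * (2 * (2 * r) + 1) := by
  have hside : S ⊆ {z | G.dist x z ≤ 2 * r} ∨ Sᶜ ⊆ {z | G.dist x z ≤ 2 * r} := by
    by_contra! hfar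
    simp only [Set.not_subset, Set.mem_ofPred_eq, not_le] at hfar
    exact not_isDeepCut hG htr ⟨hS, hfar.1, hfar.2⟩
  have hball : Nat.card V ≤ 4 * {z | G.dist x z ≤ 2 * r}.ncard := hside.elim
    (fun h ↦ hcard.trans (Nat.mul_le_mul_left 4 (Set.ncard_le_ncard h)))
    (fun h ↦ hcard'.trans (Nat.mul_le_mul_left 4 (Set.ncard_le_ncard h)))
  by_contra! hlt
  have := succ_mul_ncard_ball_le_card hG htr x hlt
  have : Nonempty V := ⟨x⟩
  have hpos : 0 < Nat.card V := Nat.card_pos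
  omega

end Packing

section Isoperimetry

open MulAction

variable {G V : Type*} [Group G] [MulAction G V] {r : V → V → Prop} {A Z : Set V} {u v : V} {k : ℕ}

lemma card_mul_ncard_smul_mem [IsPretransitive G V] (u : V) (T : Set V) :
    Nat.card V * {g : G | g • u ∈ T}.ncard = Nat.card G * T.ncard := by
  choose h hh using fun v : V ↦ exists_smul_eq G u v
  let e : V × {g : G | g • u ∈ T} ≃ G × T :=
    { toFun := fun a ↦ (a.2 * (h a.1)⁻¹, ⟨a.2.1 • u, a.2.2⟩)
      invFun := fun b ↦ (b.1⁻¹ • (b.2 : V), ⟨b.1 * h (b.1⁻¹ • (b.2 : V)), by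
        simp [mul_smul, hh]⟩)
      left_inv := by
        rintro ⟨v, g, hg⟩
        have hv : (g * (h v)⁻¹)⁻¹ • g • u = v := by
          rw [smul_smul, mul_inv_rev, inv_mul_cancel_right, inv_inv, hh]
        refine Prod.ext hv (Subtype.ext ?_)
        dsimp only
        rw [hv, inv_mul_cancel_right]
      right_inv := by
        rintro ⟨g, b, hb⟩
        simp [mul_smul, hh] }
  simpa only [Nat.card_prod, Nat.card_coe_set_eq] using Nat.card_congr e

variable [Finite G]

lemma sum_ncard_smul_mem_notMem [Fintype V] (u : V) (A : Set V) :
    ∑ v, {g : G | g • u ∈ A ∧ g • v ∉ A}.ncard = {g : G | g • u ∈ A}.ncard * Aᶜ.ncard := by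
  let e : (Σ v, {g : G | g • u ∈ A ∧ g • v ∉ A}) ≃ {g : G | g • u ∈ A} × (Aᶜ : Set V) :=
    { toFun := fun a ↦ (⟨a.2, a.2.2.1⟩, ⟨a.2.1 • a.1, a.2.2.2⟩)
      invFun := fun b ↦ ⟨b.1.1⁻¹ • b.2.1, b.1, b.1.2, by
        rw [smul_inv_smul]
        exact b.2.2⟩
      left_inv := fun a ↦ Sigma.subtype_ext (inv_smul_smul _ _) rfl
      right_inv := fun b ↦ Prod.ext rfl (Subtype.ext (smul_inv_smul _ _)) }
  simpa only [Nat.card_sigma, Nat.card_prod, Nat.card_coe_set_eq] using Nat.card_congr e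

variable [IsPretransitive G V]

lemma card_mul_ncard_smul_mem_notMem_le (hr : ∀ (g : G) ⦃a b⦄, r a b → r (g • a) (g • b))
    (hA : IsOutClosed r Z A) (h : ReachLE r k u v) :
    Nat.card V * {g : G | g • u ∈ A ∧ g • v ∉ A}.ncard ≤ Nat.card G * (k * Z.ncard) := by
  induction h with
  | refl k u => simp
  | @head k u w v huw _ ih =>
    have hsub : {g : G | g • u ∈ A ∧ g • v ∉ A} ⊆
        {g | g • w ∈ A ∧ g • v ∉ A} ∪ {g | g • w ∈ Z} := fun g hg ↦
      (hA hg.1 (hr g huw)).imp_left fun hw ↦ ⟨hw, hg.2⟩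
    have hle := (Set.ncard_le_ncard hsub).trans (Set.ncard_union_le _ _)
    calc _ ≤ Nat.card V * ({g : G | g • w ∈ A ∧ g • v ∉ A}.ncard + {g : G | g • w ∈ Z}.ncard) :=
          Nat.mul_le_mul_left _ hle
      _ ≤ Nat.card G * (k * Z.ncard) + Nat.card G * Z.ncard := by
          rw [mul_add, card_mul_ncard_smul_mem]
          exact Nat.add_le_add_right ih _
      _ = _ := by ring

variable (G) in
theorem ncard_mul_ncard_compl_le [Finite V] (hr : ∀ (g : G) ⦃a b⦄, r a b → r (g • a) (g • b))
    (hA : IsOutClosed r Z A) (hk : ∀ u v, ReachLE r k u v) :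
    A.ncard * Aᶜ.ncard ≤ Nat.card V * (k * Z.ncard) := by
  cases nonempty_fintype V
  rcases isEmpty_or_nonempty V with _ | ⟨⟨u⟩⟩
  · simp [Set.eq_empty_of_isEmpty A]
  refine Nat.le_of_mul_le_mul_left (c := Nat.card G) ?_ Nat.card_pos
  calc Nat.card G * (A.ncard * Aᶜ.ncard)
      = Nat.card V * ∑ v, {g : G | g • u ∈ A ∧ g • v ∉ A}.ncard := by
        rw [sum_ncard_smul_mem_notMem, ← mul_assoc, ← mul_assoc, card_mul_ncard_smul_mem]
    _ ≤ ∑ _v : V, Nat.card G * (k * Z.ncard) := by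
        rw [Finset.mul_sum]
        exact Finset.sum_le_sum fun v _ ↦ card_mul_ncard_smul_mem_notMem_le hr hA (hk u v)
    _ = Nat.card G * (Nat.card V * (k * Z.ncard)) := by
        rw [Finset.sum_const, Finset.card_univ, ← Nat.card_eq_fintype_card, smul_eq_mul]
        ring

end Isoperimetry

section LongestCycle

variable {V : Type*} {D : Digraph V} {A Z : Set V} {u v x : V} {k ℓ : ℕ}

lemma reflTransGen_apply_self [Finite V] {r : V → V → Prop} {f : V → V}
    (hf : Function.Injective f) (hr : ∀ ⦃a b⦄, r a b → r (f a) (f b)) (hu : r u (f u)) :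
    ReflTransGen r (f u) u := by
  have hstep (n : ℕ) : r (f^[n] u) (f^[n + 1] u) := by
    induction n with
    | zero => exact hu
    | succ n ih =>
      rw [Function.iterate_succ_apply', Function.iterate_succ_apply']
      exact hr ih
  have hreach (n : ℕ) : ReflTransGen r (f u) (f^[n + 1] u) := by
    induction n with
    | zero => exact .refl
    | succ n ih => exact ih.tail (hstep (n + 1))
  obtain ⟨n, hn, hperiod⟩ := hf.mem_periodicPts u
  obtain ⟨n, rfl⟩ := Nat.exists_eq_add_of_le' hn
  have hreturn : f^[n + 1] u = u := hperiod
  simpa only [hreturn] using hreach n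

lemma exists_isDirectedCycle_of_adj [Finite V] (hD : D.IsVertexTransitive) (huv : D.Adj u v)
    (hne : u ≠ v) : ∃ C, D.IsDirectedCycle C ∧ ReachLE D.Adj C.length v u := by
  obtain ⟨φ, rfl⟩ := hD u v
  have hback : ReflTransGen D.Adj (φ u) u :=
    reflTransGen_apply_self φ.injective (fun _ _ ↦ φ.map_rel_iff.2) huv
  obtain ⟨C, hC, -, hreach⟩ := exists_isDirectedCycle_of_avoidReach (l := [])
    (by simpa using huv) (by simpa using hne)
    (ReflTransGen.mono (fun _ _ hab ↦ ⟨hab, List.not_mem_nil⟩) _ _ hback)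
  exact ⟨C, hC, hreach⟩

lemma exists_isDirectedCycle [Finite V] [Nontrivial V] (hc : D.IsConnected)
    (hD : D.IsVertexTransitive) : ∃ C, D.IsDirectedCycle C := by
  obtain ⟨u⟩ := hc.nonempty
  obtain ⟨v, huv⟩ := hc.preconnected.exists_adj_of_nontrivial u
  obtain ⟨hne, hadj | hadj⟩ := (SimpleGraph.fromRel_adj _ _ _).1 huv
  · exact (exists_isDirectedCycle_of_adj hD hadj hne).imp fun _ ↦ And.left
  · exact (exists_isDirectedCycle_of_adj hD hadj hne.symm).imp fun _ ↦ And.left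

lemma exists_iso_toSimpleGraphInclusive (hD : D.IsVertexTransitive) (u v : V) :
    ∃ φ : D.toSimpleGraphInclusive ≃g D.toSimpleGraphInclusive, φ u = v := by
  obtain ⟨φ, hφ⟩ := hD u v
  refine ⟨⟨φ.toEquiv, fun {a b} ↦ ?_⟩, hφ⟩
  simp only [Digraph.toSimpleGraphInclusive, SimpleGraph.fromRel_adj]
  exact and_congr φ.injective.ne_iff (or_congr φ.map_rel_iff φ.map_rel_iff)

namespace ReachLE

lemma of_adj [Finite V] (hD : D.IsVertexTransitive)
    (hℓ : ∀ C, D.IsDirectedCycle C → C.length ≤ ℓ) (huv : D.toSimpleGraphInclusive.Adj u v) :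
    ReachLE D.Adj ℓ u v := by
  obtain ⟨hne, hadj | hadj⟩ := (SimpleGraph.fromRel_adj _ _ _).1 huv
  · obtain ⟨C, hC, -⟩ := exists_isDirectedCycle_of_adj hD hadj hne
    exact (head hadj (refl 0 v)).mono (by linarith [hC.1, hℓ C hC])
  · obtain ⟨C, hC, hreach⟩ := exists_isDirectedCycle_of_adj hD hadj hne.symm
    exact hreach.mono (hℓ C hC)

lemma of_walk {G : SimpleGraph V} {r : V → V → Prop} (hG : ∀ ⦃a b⦄, G.Adj a b → ReachLE r k a b)
    (p : G.Walk u v) : ReachLE r (p.length * k) u v := by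
  induction p with
  | nil => exact refl _ _
  | cons huv p ih =>
    rw [SimpleGraph.Walk.length_cons, Nat.succ_mul, add_comm]
    exact (hG huv).trans ih

lemma dist_le (h : ReachLE D.Adj k u v) (hc : D.IsConnected) :
    D.toSimpleGraphInclusive.dist u v ≤ k := by
  induction h with
  | refl => simp
  | @head k u w v huw _ ih =>
    have hdist : D.toSimpleGraphInclusive.dist u w ≤ 1 := by
      rcases eq_or_ne u w with rfl | hne
      · simp
      · exact (SimpleGraph.dist_eq_one_iff_adj.2
          ((SimpleGraph.fromRel_adj _ _ _).2 ⟨hne, .inl huw⟩)).le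
    have := SimpleGraph.Connected.dist_triangle hc (u := u) (v := w) (w := v)
    omega

end ReachLE

lemma exists_forall_dist_lt [Nonempty V] (hc : D.IsConnected) {l : List V}
    (hch : l.IsChain D.Adj) (hlen : l.length ≤ ℓ) :
    ∃ x, ∀ z ∈ l, D.toSimpleGraphInclusive.dist x z < ℓ := by
  cases l with
  | nil => exact ⟨Classical.arbitrary V, by simp⟩
  | cons x l => exact ⟨x, fun z hz ↦ ((ReachLE.of_isChain hch hz).dist_le hc).trans_lt hlen⟩

lemma IsOutClosed.isCutNear (hA : IsOutClosed D.Adj Z A) (hc : D.IsConnected)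
    (hℓ : ∀ ⦃a b⦄, D.toSimpleGraphInclusive.Adj a b → ReachLE D.Adj ℓ a b)
    (hZ : ∀ z ∈ Z, D.toSimpleGraphInclusive.dist x z < ℓ) :
    IsCutNear D.toSimpleGraphInclusive A x (2 * ℓ) := by
  intro a b ha hb hab
  obtain ⟨z, hz, haz⟩ := (hℓ hab).exists_mem_of_isOutClosed hA ha hb
  have hxz := hZ z hz
  have haz' := haz.dist_le hc
  rw [SimpleGraph.dist_comm] at haz'
  have hxa := SimpleGraph.Connected.dist_triangle hc (u := x) (v := z) (w := a)
  have hxb := SimpleGraph.Connected.dist_triangle hc (u := x) (v := a) (w := b)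
  rw [SimpleGraph.dist_eq_one_iff_adj.2 hab] at hxb
  omega

lemma ncard_mul_ncard_compl_le_of_isVertexTransitive [Finite V] (hD : D.IsVertexTransitive)
    (hA : IsOutClosed D.Adj Z A) (hk : ∀ u v, ReachLE D.Adj k u v) :
    A.ncard * Aᶜ.ncard ≤ Nat.card V * (k * Z.ncard) := by
  have : Finite (D.Adj ≃r D.Adj) := DFunLike.finite _
  have : MulAction.IsPretransitive (D.Adj ≃r D.Adj) V := ⟨hD⟩
  exact ncard_mul_ncard_compl_le (D.Adj ≃r D.Adj) (fun φ _ _ ↦ φ.map_rel_iff.2) hA hk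

theorem card_le_of_forall_length_le [Finite V] [Nontrivial V] (hc : D.IsConnected)
    (hD : D.IsVertexTransitive) (hℓ : ∀ C, D.IsDirectedCycle C → C.length ≤ ℓ) :
    Nat.card V ≤ (9 * ℓ) ^ 3 := by
  obtain ⟨C, hC⟩ := exists_isDirectedCycle hc hD
  have hℓ2 : 2 ≤ ℓ := hC.1.trans (hℓ C hC)
  by_contra! hbig
  have hlarge : 4 * ℓ ≤ 3 * Nat.card V := by
    have := Nat.le_self_pow three_ne_zero (9 * ℓ)
    omega
  obtain ⟨l, A, hch, hlen, hA, hcard, hcard'⟩ :=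
    exists_isOutClosed_isChain (by omega) hℓ hlarge
  obtain ⟨x, hx⟩ := exists_forall_dist_lt hc hch hlen
  have hadj ⦃a b : V⦄ : D.toSimpleGraphInclusive.Adj a b → ReachLE D.Adj ℓ a b := .of_adj hD hℓ
  have hdiam (u v : V) : ReachLE D.Adj (36 * ℓ * ℓ) u v := by
    obtain ⟨p, hp⟩ := SimpleGraph.Connected.exists_walk_length_eq_dist hc u v
    have hdist := dist_lt_of_isCutNear hc (exists_iso_toSimpleGraphInclusive hD)
      (hA.isCutNear hc hadj hx) hcard hcard' u v
    exact (ReachLE.of_walk hadj p).mono (Nat.mul_le_mul_right ℓ (by omega))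
  have hiso := ncard_mul_ncard_compl_le_of_isVertexTransitive hD hA hdiam
  have hZ : {x | x ∈ l}.ncard ≤ ℓ := (ncard_setOf_mem_le l).trans hlen
  refine hbig.not_ge (Nat.le_of_mul_le_mul_left (c := Nat.card V) ?_ Nat.card_pos)
  calc Nat.card V * Nat.card V ≤ (4 * A.ncard) * (4 * Aᶜ.ncard) := Nat.mul_le_mul hcard hcard'
    _ = 16 * (A.ncard * Aᶜ.ncard) := by ring
    _ ≤ 16 * (Nat.card V * (36 * ℓ * ℓ * ℓ)) := by
      refine Nat.mul_le_mul_left 16 (hiso.trans ?_)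
      gcongr
    _ = Nat.card V * (576 * ℓ ^ 3) := by ring
    _ ≤ Nat.card V * (9 * ℓ) ^ 3 := by
      rw [mul_pow]
      gcongr
      norm_num

theorem exists_isDirectedCycle_card_le [Finite V] [Nontrivial V] (hc : D.IsConnected)
    (hD : D.IsVertexTransitive) :
    ∃ C, D.IsDirectedCycle C ∧ Nat.card V ≤ (9 * C.length) ^ 3 := by
  classical
  cases nonempty_fintype V
  have hnodup : Finite {C : Cycle V | C.Nodup} := inferInstanceAs (Finite {C : Cycle V // C.Nodup})
  have hfin : {C | D.IsDirectedCycle C}.Finite :=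
    (Set.toFinite {C : Cycle V | C.Nodup}).subset fun _ hC ↦ hC.2.1
  obtain ⟨C, hC, hmax⟩ :=
    Set.exists_max_image {C | D.IsDirectedCycle C} Cycle.length hfin (exists_isDirectedCycle hc hD)
  exact ⟨C, hC, card_le_of_forall_length_le hc hD hmax⟩

end LongestCycle

theorem theorem1p2 :
    ∃ c : ℝ, 0 < c ∧
      ∀ (V : Type*) [Fintype V] (D : Digraph V),
        2 ≤ Fintype.card V → D.IsConnected → D.IsVertexTransitive →
          ∃ C : Cycle V, D.IsDirectedCycle C ∧
            c * (Fintype.card V : ℝ) ^ (1 / 3 : ℝ) ≤ (C.length : ℝ) := by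
  refine ⟨1 / 9, by norm_num, fun V _ D hn hc hD ↦ ?_⟩
  have : Nontrivial V := Fintype.one_lt_card_iff_nontrivial.1 hn
  obtain ⟨C, hC, hcard⟩ := exists_isDirectedCycle_card_le hc hD
  refine ⟨C, hC, ?_⟩
  have hcard' : (Fintype.card V : ℝ) ≤ (9 * C.length : ℝ) ^ 3 := by
    rw [← Nat.card_eq_fintype_card]
    exact_mod_cast hcard
  have hroot : (Fintype.card V : ℝ) ^ (1 / 3 : ℝ) ≤ 9 * C.length := by
    rw [one_div, Real.rpow_inv_le_iff_of_pos (by positivity) (by positivity) (by norm_num)]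
    exact_mod_cast hcard'
  linarith
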